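/- Let $\{\boldsymbol\xi_{k,j,i},\boldsymbol\varepsilon_k : k,j\in\mathbb N,\ i\in\{1,2\}\}$ be independent $\mathbb Z_+^2$-valued random vectors such that, for each $i\in\{1,2\}$, the vectors $\boldsymbol\xi_{k,j,i}$, $k,j\in\mathbb N$, are identically distributed, and the vectors $\boldsymbol\varepsilon_k$, $k\in\mathbb N$, are identically distributed. Let $(\boldsymbol X_k)_{k\ge 0}$, $\boldsymbol X_k=(X_{k,1},X_{k,2})^\top$, be the 2-type Galton--Watson process with immigration given by $\boldsymbol X_0=\boldsymbol 0$ and $$\boldsymbol X_k=\sum_{j=1}^{X_{k-1,1}}\boldsymbol\xi_{k,j,1}+\sum_{j=1}^{X_{k-1,2}}\boldsymbol\xi_{k,j,2}+\boldsymbol\varepsilon_k,\qquad k\in\mathbb N .$$ Assume that the process is doubly symmetric and critical: there are $\alpha,\beta\in(0,1)$ with $\alpha+\beta=1$ such that the offspring mean matrix, whose $i$-th column is $\mathbb E(\boldsymbol\xi_{1,1,i})$, equals $\begin{bmatrix}\alpha&\beta\\ \beta&\alpha\end{bmatrix}$. Let $\ell\in\mathbb N=\{1,2,\dots\}$ and suppose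 that $\mathbb E(\|\boldsymbol\xi_{1,1,1}\|^\ell)$, $\mathbb E(\|\boldsymbol\xi_{1,1,2}\|^\ell)$ and $\mathbb E(\|\boldsymbol\varepsilon_1\|^\ell)$ are finite. For $k\in\mathbb N$ put $$\boldsymbol M_k=\boldsymbol X_k-\mathbb E(\boldsymbol X_k\mid \sigma(\boldsymbol X_0,\dots,\boldsymbol X_{k-1})),\qquad U_k=X_{k,1}+X_{k,2},\qquad V_k=X_{k,1}-X_{k,2},$$ and let $\boldsymbol M_k^{\otimes\ell}\in\mathbb R^{2^\ell}$ denote the $\ell$-fold Kronecker power. Then all the expectations below exist and are finite, and $$\mathbb E(\|\boldsymbol X_k\|^\ell)=O(k^\ell),\qquad \mathbb E(\boldsymbol M_k^{\otimes\ell})=O(k^{\lfloor\ell/2\rfloor}),\qquad \mathbb E(U_k^\ell)=O(k^\ell),$$ and $\mathbb E(V_k^{2j})=O(k^j)$ for every integer $j\ge 0$ with $2j\le\ell$. Here $a_k=O(k^p)$ means $\sup_{k\in\mathbb N}k^{-p}\|a_k\|<\infty$. -/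

import Mathlib

open MeasureTheory ProbabilityTheory

namespace GWI

/-- Labels of the driving random vectors of a 2-type Galton–Watson process with immigration. -/
inductive Idx : Type
  | init : Idx
  | offspring (k j : ℕ) (i : Fin 2) : Idx
  | immigration (k : ℕ) : Idx

/-- The family consisting of the initial value `x₀`, all offspring vectors `ξ k j i` and all
immigration vectors `ε k`. -/
def driving {Ω : Type*} (x₀ : Ω → Fin 2 → ℕ) (ξ : ℕ → ℕ → Fin 2 → Ω → Fin 2 → ℕ)
    (ε : ℕ → Ω → Fin 2 → ℕ) : Idx → Ω → Fin 2 → ℕ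
  | .init => x₀
  | .offspring k j i => ξ k j i
  | .immigration k => ε k

/-- `X` is a 2-type Galton–Watson process with immigration on the probability space `(Ω, μ)`.
`X k ω i` is the number of individuals of type `i` in generation `k`.  Offspring and immigration
are indexed from `0`: `ξ k j i ω r` is the number of children of type `r` of the `j`-th individual
of type `i` of generation `k` (these children belong to generation `k + 1`), and `ε k ω r` is the
number of immigrants of type `r` arriving in generation `k + 1`. -/
structure IsProcess {Ω : Type*} [MeasurableSpace Ω] (μ : Measure Ω)
    (X : ℕ → Ω → Fin 2 → ℕ) (ξ : ℕ → ℕ → Fin 2 → Ω → Fin 2 → ℕ)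
    (ε : ℕ → Ω → Fin 2 → ℕ) : Prop where
  measurable_driving : ∀ a, Measurable (driving (X 0) ξ ε a)
  indep : iIndepFun (driving (X 0) ξ ε) μ
  identDistrib_offspring : ∀ k j i, IdentDistrib (ξ k j i) (ξ 0 0 i) μ μ
  identDistrib_immigration : ∀ k, IdentDistrib (ε k) (ε 0) μ μ
  recursion : ∀ k ω r, X (k + 1) ω r =
    (∑ j ∈ Finset.range (X k ω 0), ξ k j 0 ω r) + (∑ j ∈ Finset.range (X k ω 1), ξ k j 1 ω r)
      + ε k ω r

/-- A vector of counts as an element of Euclidean `ℝ²`. -/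
noncomputable def toVec (x : Fin 2 → ℕ) : EuclideanSpace ℝ (Fin 2) :=
  WithLp.toLp 2 fun i => (x i : ℝ)

/-- The offspring mean matrix: its `i`-th column is the mean vector of the offspring of an
individual of type `i`. -/
noncomputable def offspringMean {Ω : Type*} [MeasurableSpace Ω] (μ : Measure Ω)
    (ξ : ℕ → ℕ → Fin 2 → Ω → Fin 2 → ℕ) : Matrix (Fin 2) (Fin 2) ℝ :=
  Matrix.of fun r i => ∫ ω, (ξ 0 0 i ω r : ℝ) ∂μ

/-- The σ-algebra generated by `X 0, …, X n`. -/
abbrev history {Ω : Type*} (X : ℕ → Ω → Fin 2 → ℕ) (n : ℕ) : MeasurableSpace Ω :=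
  ⨆ m ≤ n, MeasurableSpace.comap (X m) inferInstance

/-- The martingale difference `M_k = X_k - E(X_k | F_{k-1})`; it is used for `k ≥ 1` only. -/
noncomputable def M {Ω : Type*} [MeasurableSpace Ω] (μ : Measure Ω)
    (X : ℕ → Ω → Fin 2 → ℕ) (k : ℕ) (ω : Ω) : EuclideanSpace ℝ (Fin 2) :=
  toVec (X k ω) - (μ[fun ω' => toVec (X k ω') | history X (k - 1)]) ω

/-- The `ℓ`-fold Kronecker power of a vector of `ℝ²`, a vector with `2 ^ ℓ` coordinates, which are
labelled by the multi-indices `(s 0, …, s (ℓ - 1))`. -/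
noncomputable def kronPow (ℓ : ℕ) (v : EuclideanSpace ℝ (Fin 2)) :
    EuclideanSpace ℝ (Fin ℓ → Fin 2) :=
  WithLp.toLp 2 fun s => ∏ t, v (s t)

/-- The total population `U_k = X_{k,1} + X_{k,2}`. -/
def U {Ω : Type*} (X : ℕ → Ω → Fin 2 → ℕ) (k : ℕ) (ω : Ω) : ℝ :=
  (X k ω 0 : ℝ) + (X k ω 1 : ℝ)

/-- The difference `V_k = X_{k,1} - X_{k,2}`. -/
def V {Ω : Type*} (X : ℕ → Ω → Fin 2 → ℕ) (k : ℕ) (ω : Ω) : ℝ :=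
  (X k ω 0 : ℝ) - (X k ω 1 : ℝ)

/-- For real- or vector-valued random elements `Y 1, Y 2, …`: all expectations `E(Y k)` exist and
`sup_{k ≥ 1} k ^ (-p) ‖E(Y k)‖ < ∞`. -/
def MeanBigO {Ω : Type*} [MeasurableSpace Ω] (μ : Measure Ω) {F : Type*}
    [NormedAddCommGroup F] [NormedSpace ℝ F] (Y : ℕ → Ω → F) (p : ℕ) : Prop :=
  (∀ k, 1 ≤ k → Integrable (Y k) μ) ∧
    ∃ C : ℝ, ∀ k : ℕ, 1 ≤ k → ‖∫ ω, Y k ω ∂μ‖ ≤ C * (k : ℝ) ^ p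

end GWI

/-! Given the population `x` of generation `k`, the next one is a sum of `x 0 + x 1 + 1` independent
driving vectors, the immigrants counting as one of them. Its deviation from the conditional mean is
thus a sum of `n = x 0 + x 1 + 1` independent centred vectors, and a mixed moment of order `p` of
such a sum is `O(n ^ ⌊p/2⌋)`, because a summand used exactly once contributes zero
(`exists_abs_integral_prod_sum_le`, `IsProcess.exists_moment_bound`).

The rows `(1, 1)` and `(1, -1)` are left eigenvectors of the mean matrix, with eigenvalues `1` and
`δ = α - β`, `|δ| < 1`. For the total, one step raises the moment of order `p` of `1 + U` by at most
a constant times the moment of order `p - 1`, and summation over generations gives `O(k ^ p)`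
(`IsProcess.exists_total_moment_bound`). The difference satisfies `V_{k+1} = δ V_k + noise`, where
the noise has moment of order `2j` of size `O(k ^ j)`; the contraction preserves this order
(`IsProcess.exists_diff_moment_bound`). The coordinates of the Kronecker power are products of
deviations, so conditioning on `X_k` reduces them to the moment of order `⌊ℓ/2⌋` of `1 + U_k`. -/

namespace GWI

/-! ### Fubini and Tonelli for independent random elements -/

section Independence

variable {Ω E G : Type*} [MeasurableSpace Ω] [MeasurableSpace E] [MeasurableSpace G]
  {μ : Measure Ω} [IsProbabilityMeasure μ] {H : Ω → E} {Z : Ω → G} {f : E → G → ℝ}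

/-- The joint law is a product, so Tonelli applies. This is how integrability is carried to the next
generation, where it is not known beforehand. -/
theorem integrable_uncurry_of_indepFun (h : IndepFun H Z μ) (hH : Measurable H)
    (hZ : Measurable Z) (hf : Measurable (Function.uncurry f))
    (h₁ : ∀ x, Integrable (fun ω => f x (Z ω)) μ)
    (h₂ : Integrable (fun ω => ∫ ω', |f (H ω) (Z ω')| ∂μ) μ) :
    Integrable (fun ω => f (H ω) (Z ω)) μ := by
  have hm := (indepFun_iff_map_prod_eq_prod_map_map hH.aemeasurable hZ.aemeasurable).1 h
  have : IsProbabilityMeasure (μ.map Z) := Measure.isProbabilityMeasure_map hZ.aemeasurable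
  have hfx : ∀ x, Measurable (f x) := fun x => hf.of_uncurry_left
  have key : Integrable (Function.uncurry f) ((μ.map H).prod (μ.map Z)) := by
    rw [integrable_prod_iff hf.aestronglyMeasurable]
    refine ⟨Filter.Eventually.of_forall fun x => ?_, ?_⟩
    · exact (integrable_map_measure (hfx x).aestronglyMeasurable hZ.aemeasurable).2 (h₁ x)
    · have hs : StronglyMeasurable fun x => ∫ y, ‖Function.uncurry f (x, y)‖ ∂(μ.map Z) :=
        hf.stronglyMeasurable.norm.integral_prod_right'
      rw [integrable_map_measure hs.aestronglyMeasurable hH.aemeasurable]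
      refine h₂.congr (Filter.Eventually.of_forall fun ω => ?_)
      simp only [Function.comp, Function.uncurry_apply_pair, Real.norm_eq_abs]
      rw [integral_map hZ.aemeasurable (hfx _).abs.aestronglyMeasurable]
  rw [← hm, integrable_map_measure hf.aestronglyMeasurable (hH.prodMk hZ).aemeasurable] at key
  exact key

theorem integrable_integral_of_indepFun (h : IndepFun H Z μ) (hH : Measurable H)
    (hZ : Measurable Z) (hf : Measurable (Function.uncurry f))
    (hi : Integrable (fun ω => f (H ω) (Z ω)) μ) :
    Integrable (fun ω => ∫ ω', f (H ω) (Z ω') ∂μ) μ ∧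
    ∫ ω, f (H ω) (Z ω) ∂μ = ∫ ω, ∫ ω', f (H ω) (Z ω') ∂μ ∂μ := by
  have hm := (indepFun_iff_map_prod_eq_prod_map_map hH.aemeasurable hZ.aemeasurable).1 h
  have : IsProbabilityMeasure (μ.map Z) := Measure.isProbabilityMeasure_map hZ.aemeasurable
  have : IsProbabilityMeasure (μ.map H) := Measure.isProbabilityMeasure_map hH.aemeasurable
  have hfx : ∀ x, Measurable (f x) := fun x => hf.of_uncurry_left
  have key : Integrable (Function.uncurry f) ((μ.map H).prod (μ.map Z)) := by
    rw [← hm, integrable_map_measure hf.aestronglyMeasurable (hH.prodMk hZ).aemeasurable]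
    exact hi
  have hin : ∀ x, ∫ y, Function.uncurry f (x, y) ∂(μ.map Z) = ∫ ω', f x (Z ω') ∂μ := fun x => by
    simp only [Function.uncurry_apply_pair]
    rw [integral_map hZ.aemeasurable (hfx _).aestronglyMeasurable]
  have hs : StronglyMeasurable fun x => ∫ ω', f x (Z ω') ∂μ := by
    simp_rw [← hin]
    exact hf.stronglyMeasurable.integral_prod_right'
  constructor
  · have := key.integral_prod_left
    simp_rw [hin] at this
    exact (integrable_map_measure hs.aestronglyMeasurable hH.aemeasurable).1 this
  · have := integral_prod _ key
    simp_rw [hin] at this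
    rw [integral_map hH.aemeasurable hs.aestronglyMeasurable, ← hm,
      integral_map (hH.prodMk hZ).aemeasurable hf.aestronglyMeasurable] at this
    exact this

end Independence

/-! ### Mixed moments of sums of independent centred vectors -/

theorem prod_sum_insert {Ω ι τ : Type*} [DecidableEq ι] [DecidableEq τ] {Y : ι → Ω → τ → ℝ}
    {F : Finset ι} {b : ι} (hb : b ∉ F)
    (T : Finset τ) (ω : Ω) :
    ∏ t ∈ T, ∑ a ∈ insert b F, Y a ω t =
      ∑ P ∈ T.powerset, (∏ t ∈ P, ∑ a ∈ F, Y a ω t) * ∏ t ∈ T \ P, Y b ω t := by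
  rw [← Finset.prod_add]
  exact Finset.prod_congr rfl fun t _ => by rw [Finset.sum_insert hb, add_comm]

section ProductMoments

variable {Ω ι τ : Type*} [MeasurableSpace Ω] {μ : Measure Ω} {Y : ι → Ω → τ → ℝ}

theorem indepFun_prod_sum_prod (hm : ∀ a, Measurable (Y a)) (hY : iIndepFun Y μ) {F : Finset ι}
    {b : ι} (hb : b ∉ F) (P Q : Finset τ) :
    IndepFun (fun ω => ∏ t ∈ P, ∑ a ∈ F, Y a ω t) (fun ω => ∏ t ∈ Q, Y b ω t) μ := by
  have h := (hY.indepFun_finsetSum_of_notMem hm hb).comp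
    (φ := fun v : τ → ℝ => ∏ t ∈ P, v t) (ψ := fun v : τ → ℝ => ∏ t ∈ Q, v t)
    (Finset.measurable_prod _ fun t _ => measurable_pi_apply t)
    (Finset.measurable_prod _ fun t _ => measurable_pi_apply t)
  have e : (fun v : τ → ℝ => ∏ t ∈ P, v t) ∘ (∑ a ∈ F, Y a) =
      fun ω => ∏ t ∈ P, ∑ a ∈ F, Y a ω t := by
    ext ω
    simp [Finset.sum_apply]
  rw [e] at h
  exact h

theorem integrable_prod_sum [IsProbabilityMeasure μ] (hm : ∀ a, Measurable (Y a))
    (hY : iIndepFun Y μ)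
    (hint : ∀ a (T : Finset τ), Integrable (fun ω => ∏ t ∈ T, Y a ω t) μ) (F : Finset ι) :
    ∀ T : Finset τ, Integrable (fun ω => ∏ t ∈ T, ∑ a ∈ F, Y a ω t) μ := by
  classical
  induction F using Finset.induction_on with
  | empty => intro T; simp
  | insert b F hb ih =>
    intro T
    simp_rw [prod_sum_insert hb]
    exact integrable_finsetSum _ fun P _ =>
      (indepFun_prod_sum_prod hm hY hb P (T \ P)).integrable_mul (ih P) (hint b _)

/-- Adding one summand `b` and expanding, `P` is the set of factors that keep the old sum. `P = T`
returns the old moment, `T \ P` of size one gives zero by centring, and the other terms are `O(|F| ^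
(⌊|T|/2⌋ - 1))` by induction on `T`. Adding up these increments over `F` raises the exponent by one.
-/
theorem exists_abs_integral_prod_sum_le [IsProbabilityMeasure μ] (hm : ∀ a, Measurable (Y a))
    (hY : iIndepFun Y μ)
    (hint : ∀ a (T : Finset τ), Integrable (fun ω => ∏ t ∈ T, Y a ω t) μ)
    (hzero : ∀ a t, ∫ ω, Y a ω t ∂μ = 0) {K : ℝ} (hK : 0 ≤ K)
    (hbound : ∀ a (T : Finset τ), |∫ ω, ∏ t ∈ T, Y a ω t ∂μ| ≤ K) (T : Finset τ) :
    ∃ C : ℝ, 0 ≤ C ∧ ∀ F : Finset ι,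
      |∫ ω, ∏ t ∈ T, ∑ a ∈ F, Y a ω t ∂μ| ≤ C * (F.card : ℝ) ^ (T.card / 2) := by
  classical
  induction T using Finset.strongInduction with
  | H T ih =>
  choose! C hC0 hC using ih
  set D : ℝ := ∑ P ∈ T.powerset.filter (fun P => 2 ≤ (T \ P).card), C P * K with hD
  have hsub : ∀ P ∈ T.powerset.filter (fun P => 2 ≤ (T \ P).card), P ⊂ T := by
    intro P hP
    rw [Finset.mem_filter, Finset.mem_powerset] at hP
    refine hP.1.ssubset_of_ne ?_
    rintro rfl
    simp at hP
  have hD0 : 0 ≤ D := Finset.sum_nonneg fun P hP => mul_nonneg (hC0 P (hsub P hP)) hK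
  -- The extra `1` is needed for empty `T`, where the moment equals `1`.
  refine ⟨D + 1, by positivity, fun F => ?_⟩
  induction F using Finset.induction_on with
  | empty =>
    rcases T.eq_empty_or_nonempty with rfl | hT
    · simp [hD0]
    · have : ∀ ω, ∏ t ∈ T, ∑ a ∈ (∅ : Finset ι), Y a ω t = 0 := fun ω => by
        simp [Finset.prod_const, hT.card_pos.ne']
      simp_rw [this]
      simp only [integral_zero, abs_zero]
      positivity
  | insert b F hb ihF =>
    have hint2 : ∀ P, Integrable
        (fun ω => (∏ t ∈ P, ∑ a ∈ F, Y a ω t) * ∏ t ∈ T \ P, Y b ω t) μ := fun P =>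
      (indepFun_prod_sum_prod hm hY hb P (T \ P)).integrable_mul
        (integrable_prod_sum hm hY hint F P) (hint b _)
    have hval : ∀ P, ∫ ω, (∏ t ∈ P, ∑ a ∈ F, Y a ω t) * ∏ t ∈ T \ P, Y b ω t ∂μ =
        (∫ ω, ∏ t ∈ P, ∑ a ∈ F, Y a ω t ∂μ) * ∫ ω, ∏ t ∈ T \ P, Y b ω t ∂μ := fun P =>
      (indepFun_prod_sum_prod hm hY hb P (T \ P)).integral_fun_mul_eq_mul_integral
        (integrable_prod_sum hm hY hint F P).1 (hint b _).1
    simp_rw [prod_sum_insert hb]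
    rw [integral_finsetSum _ fun P _ => hint2 P]
    simp_rw [hval]
    set g : Finset τ → ℝ := fun P =>
      (∫ ω, ∏ t ∈ P, ∑ a ∈ F, Y a ω t ∂μ) * ∫ ω, ∏ t ∈ T \ P, Y b ω t ∂μ with hg
    have hsplit : ∑ P ∈ T.powerset, g P =
        ∑ P ∈ T.powerset.filter (fun P => 2 ≤ (T \ P).card), g P + g T := by
      rw [← Finset.sum_filter_add_sum_filter_not T.powerset (fun P => 2 ≤ (T \ P).card)]
      congr 1
      refine Finset.sum_eq_single_of_mem T (by simp) fun P hP hPT => ?_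
      rw [Finset.mem_filter, Finset.mem_powerset] at hP
      have h1 : (T \ P).card = 1 := by
        have : (T \ P).Nonempty := by
          rw [Finset.sdiff_nonempty]
          exact fun h => hPT (hP.1.antisymm h)
        have := this.card_pos
        omega
      obtain ⟨t, ht⟩ := Finset.card_eq_one.1 h1
      simp [hg, ht, hzero]
    have hgT : g T = ∫ ω, ∏ t ∈ T, ∑ a ∈ F, Y a ω t ∂μ := by simp [hg]
    have hle : |∑ P ∈ T.powerset.filter (fun P => 2 ≤ (T \ P).card), g P| ≤
        D * ((F.card : ℝ) + 1) ^ (T.card / 2 - 1) := by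
      refine (Finset.abs_sum_le_sum_abs _ _).trans ?_
      rw [hD, Finset.sum_mul]
      refine Finset.sum_le_sum fun P hP => ?_
      have hPT := hsub P hP
      rw [Finset.mem_filter, Finset.card_sdiff_of_subset hPT.subset] at hP
      have h2 := hP.2
      have h3 := hC0 P hPT
      have h4 : (F.card : ℝ) ^ (P.card / 2) ≤ ((F.card : ℝ) + 1) ^ (T.card / 2 - 1) :=
        (pow_le_pow_left₀ (by positivity) (by linarith) _).trans
          (pow_le_pow_right₀ (by linarith [(Nat.cast_nonneg F.card : (0 : ℝ) ≤ _)]) (by omega))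
      rw [hg, abs_mul]
      calc _ ≤ (C P * (F.card : ℝ) ^ (P.card / 2)) * K :=
            mul_le_mul (hC P hPT F) (hbound b _) (abs_nonneg _) (by positivity)
        _ ≤ (C P * ((F.card : ℝ) + 1) ^ (T.card / 2 - 1)) * K := by gcongr
        _ = _ := by ring
    rw [hsplit, hgT, Finset.card_insert_of_notMem hb]
    push_cast
    -- When `T` has at most one element the exponent `T.card / 2 - 1` is truncated, but then no `P`
    -- omits two elements and the moment does not change.
    rcases Nat.eq_zero_or_pos (T.card / 2) with h0 | h0
    · have hempty : T.powerset.filter (fun P => 2 ≤ (T \ P).card) = ∅ := by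
        refine Finset.filter_eq_empty_iff.2 fun P hP => ?_
        have := Finset.card_le_card (Finset.sdiff_subset (s := T) (t := P))
        omega
      rw [hempty, Finset.sum_empty, zero_add, h0, pow_zero]
      rw [h0, pow_zero] at ihF
      exact ihF
    · obtain ⟨q, hq⟩ : ∃ q, T.card / 2 = q + 1 := ⟨T.card / 2 - 1, by omega⟩
      rw [hq] at hle ihF ⊢
      rw [Nat.add_sub_cancel] at hle
      have hmono : (F.card : ℝ) ^ q ≤ ((F.card : ℝ) + 1) ^ q :=
        pow_le_pow_left₀ (by positivity) (by linarith) _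
      have hnn : (0 : ℝ) ≤ F.card := Nat.cast_nonneg _
      calc _ ≤ D * ((F.card : ℝ) + 1) ^ q + (D + 1) * (F.card : ℝ) ^ (q + 1) :=
            (abs_add_le _ _).trans (add_le_add hle ihF)
        _ ≤ (D + 1) * ((F.card : ℝ) + 1) ^ q +
            (D + 1) * ((F.card : ℝ) * ((F.card : ℝ) + 1) ^ q) := by
            rw [pow_succ' (F.card : ℝ) q]
            gcongr
            linarith
        _ = _ := by ring

end ProductMoments

end GWI

/-! ### One generation step as a function of the present and of independent innovations -/

namespace GWI

/-- The label of the `j`-th individual of type `i` in generation `k`, as an embedding in `j`. -/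
def offspringEmb (k : ℕ) (i : Fin 2) : ℕ ↪ Idx :=
  ⟨fun j => Idx.offspring k j i, fun _ _ h => by simpa using h⟩

@[simp]
theorem offspringEmb_apply (k : ℕ) (i : Fin 2) (j : ℕ) :
    offspringEmb k i j = Idx.offspring k j i := rfl

/-- The labels of the individuals `j < x i` of type `i` in generation `k`, together with the label
of the immigrants of generation `k + 1`. -/
def gen (k : ℕ) (x : Fin 2 → ℕ) : Finset Idx :=
  (Finset.disjUnion ((Finset.range (x 0)).map (offspringEmb k 0))
    ((Finset.range (x 1)).map (offspringEmb k 1))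
    (by simp [Finset.disjoint_left])).cons (Idx.immigration k) (by simp)

theorem sum_gen {N : Type*} [AddCommMonoid N] (k : ℕ) (x : Fin 2 → ℕ) (g : Idx → N) :
    ∑ a ∈ gen k x, g a = (∑ j ∈ Finset.range (x 0), g (.offspring k j 0)) +
      (∑ j ∈ Finset.range (x 1), g (.offspring k j 1)) + g (.immigration k) := by
  rw [gen, Finset.sum_cons, Finset.sum_disjUnion, Finset.sum_map, Finset.sum_map, add_comm]
  simp

theorem card_gen (k : ℕ) (x : Fin 2 → ℕ) : (gen k x).card = x 0 + x 1 + 1 := by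
  simp [gen]

/-- The generation into which the individuals counted by a driving vector are born. -/
def stage : Idx → ℕ
  | .init => 0
  | .offspring k _ _ => k + 1
  | .immigration k => k + 1

theorem stage_of_mem_gen {k : ℕ} {x : Fin 2 → ℕ} {a : Idx} (ha : a ∈ gen k x) :
    stage a = k + 1 := by
  simp only [gen, Finset.mem_cons, Finset.mem_disjUnion, Finset.mem_map, Finset.mem_range,
    offspringEmb_apply] at ha
  rcases ha with rfl | ⟨j, -, rfl⟩ | ⟨j, -, rfl⟩ <;> rfl

/-- The driving vectors used in the transition from generation `k` to generation `k + 1`. -/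
def innov {Ω : Type*} (D : Idx → Ω → Fin 2 → ℕ) (k : ℕ) (ω : Ω) (a : Idx) : Fin 2 → ℕ :=
  if stage a = k + 1 then D a ω else 0

theorem innov_of_mem_gen {Ω : Type*} (D : Idx → Ω → Fin 2 → ℕ) {k : ℕ} {x : Fin 2 → ℕ} {a : Idx}
    (ha : a ∈ gen k x) (ω : Ω) : innov D k ω a = D a ω := if_pos (stage_of_mem_gen ha)

/-- The transition from a population `x` in generation `k` to the next generation. -/
def next (k : ℕ) (x : Fin 2 → ℕ) (z : Idx → Fin 2 → ℕ) : Fin 2 → ℕ := ∑ a ∈ gen k x, z a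

theorem measurable_next (k : ℕ) : Measurable (Function.uncurry (next k)) :=
  measurable_from_prod_countable_right fun x =>
    Finset.measurable_sum (gen k x) fun a _ => measurable_pi_apply a

section

variable {Ω : Type*} [MeasurableSpace Ω] {μ : Measure Ω}
  {X : ℕ → Ω → Fin 2 → ℕ} {ξ : ℕ → ℕ → Fin 2 → Ω → Fin 2 → ℕ} {ε : ℕ → Ω → Fin 2 → ℕ}

theorem IsProcess.succ_eq_next (hX : IsProcess μ X ξ ε) (k : ℕ) (ω : Ω) :
    X (k + 1) ω = next k (X k ω) (innov (driving (X 0) ξ ε) k ω) := by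
  ext r
  rw [hX.recursion, next, Finset.sum_congr rfl fun a ha => innov_of_mem_gen _ ha ω, sum_gen]
  simp [driving]

/-- The σ-algebra generated by the driving vectors with label in `S`. -/
abbrev drivingSigma {Ω : Type*} (D : Idx → Ω → Fin 2 → ℕ) (S : Set Idx) : MeasurableSpace Ω :=
  ⨆ a ∈ S, MeasurableSpace.comap (D a) inferInstance

theorem measurable_driving_of_mem {Ω : Type*} {D : Idx → Ω → Fin 2 → ℕ} {S : Set Idx} {a : Idx}
    (ha : a ∈ S) :
    Measurable[drivingSigma D S] (D a) :=
  Measurable.mono (comap_measurable (D a))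
    (le_iSup₂_of_le (f := fun a (_ : a ∈ S) => MeasurableSpace.comap (D a) inferInstance) a ha
      le_rfl) le_rfl

theorem measurable_innov {Ω : Type*} {D : Idx → Ω → Fin 2 → ℕ} (k : ℕ) :
    Measurable[drivingSigma D {a | stage a = k + 1}] (innov D k) := by
  refine @measurable_pi_lambda _ _ _ (_) _ _ fun a => ?_
  by_cases ha : stage a = k + 1
  · simp only [innov, if_pos ha]
    exact measurable_driving_of_mem ha
  · simp only [innov, if_neg ha]
    exact measurable_const

theorem IsProcess.measurable_past (hX : IsProcess μ X ξ ε) {n : ℕ} :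
    ∀ m ≤ n, Measurable[drivingSigma (driving (X 0) ξ ε) {a | stage a ≤ n}] (X m) := by
  intro m
  induction m with
  | zero =>
    intro _
    exact measurable_driving_of_mem (D := driving (X 0) ξ ε) (a := Idx.init)
      (S := {a | stage a ≤ n}) (Nat.zero_le _)
  | succ m ih =>
    intro hm
    have h1 := ih (by omega)
    have h2 : Measurable[drivingSigma (driving (X 0) ξ ε) {a | stage a ≤ n}]
        (innov (driving (X 0) ξ ε) m) := by
      refine (measurable_innov m).mono (biSup_mono fun a ha => ?_) le_rfl
      simp only [Set.mem_ofPred_eq] at ha ⊢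
      omega
    have h3 : X (m + 1) = fun ω => Function.uncurry (next m)
        (X m ω, innov (driving (X 0) ξ ε) m ω) := funext (hX.succ_eq_next m)
    rw [h3]
    exact (measurable_next m).comp (Measurable.prodMk h1 h2)

theorem IsProcess.history_le_drivingSigma (hX : IsProcess μ X ξ ε) (n : ℕ) :
    history X n ≤ drivingSigma (driving (X 0) ξ ε) {a | stage a ≤ n} :=
  iSup₂_le fun m hm => (hX.measurable_past m hm).comap_le

theorem IsProcess.drivingSigma_le (hX : IsProcess μ X ξ ε) (S : Set Idx) :
    drivingSigma (driving (X 0) ξ ε) S ≤ ‹MeasurableSpace Ω› :=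
  iSup₂_le fun a _ => (hX.measurable_driving a).comap_le

theorem IsProcess.history_le (hX : IsProcess μ X ξ ε) (n : ℕ) :
    history X n ≤ ‹MeasurableSpace Ω› :=
  (hX.history_le_drivingSigma n).trans (hX.drivingSigma_le _)

theorem measurable_history_self {Ω : Type*} (X : ℕ → Ω → Fin 2 → ℕ) (n : ℕ) :
    Measurable[history X n] (X n) :=
  Measurable.mono (comap_measurable (X n))
    (le_iSup₂_of_le (f := fun m (_ : m ≤ n) => MeasurableSpace.comap (X m) inferInstance) n le_rfl
      le_rfl) le_rfl

theorem IsProcess.measurable (hX : IsProcess μ X ξ ε) (n : ℕ) : Measurable (X n) :=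
  (measurable_history_self X n).mono (hX.history_le n) le_rfl

theorem IsProcess.measurable_innov (hX : IsProcess μ X ξ ε) (k : ℕ) :
    Measurable (innov (driving (X 0) ξ ε) k) :=
  (GWI.measurable_innov k).mono (hX.drivingSigma_le _) le_rfl

/-- The past depends on labels of stage at most `k`, the innovations on labels of stage `k + 1`. A
general `H` is allowed so that the indicator of a past event can accompany `X k`. -/
theorem IsProcess.indepFun_innov (hX : IsProcess μ X ξ ε) {E : Type*} [MeasurableSpace E] {k : ℕ}
    {H : Ω → E} (hH : Measurable[history X k] H) :
    IndepFun H (innov (driving (X 0) ξ ε) k) μ := by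
  have h := indep_iSup_of_disjoint (fun a => (hX.measurable_driving a).comap_le) hX.indep
    (S := {a | stage a ≤ k}) (T := {a | stage a = k + 1})
    (Set.disjoint_left.2 fun a (h1 : stage a ≤ k) (h2 : stage a = k + 1) => by omega)
  exact indep_of_indep_of_le_left (indep_of_indep_of_le_right h (GWI.measurable_innov k).comap_le)
    (hH.comap_le.trans (hX.history_le_drivingSigma k))

/-- The conditional mean of the next generation, given the present population `x`. -/
noncomputable def drift (μ : Measure Ω) (ξ : ℕ → ℕ → Fin 2 → Ω → Fin 2 → ℕ)
    (ε : ℕ → Ω → Fin 2 → ℕ) (x : Fin 2 → ℕ) (r : Fin 2) : ℝ :=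
  x 0 * offspringMean μ ξ r 0 + x 1 * offspringMean μ ξ r 1 + ∫ ω, (ε 0 ω r : ℝ) ∂μ

/-- A label whose driving vector has the same distribution. -/
def rep : Idx → Idx
  | .init => .init
  | .offspring _ _ i => .offspring 0 0 i
  | .immigration _ => .immigration 0

/-- There are only four representative labels, so identical distribution yields constants uniform in
all labels. -/
theorem exists_bound_of_rep (g : Idx → ℝ) : ∃ K : ℝ, 0 ≤ K ∧ ∀ a, |g (rep a)| ≤ K := by
  refine ⟨|g .init| + |g (.offspring 0 0 0)| + |g (.offspring 0 0 1)| + |g (.immigration 0)|,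
    by positivity, fun a => ?_⟩
  have h1 := abs_nonneg (g .init)
  have h2 := abs_nonneg (g (.offspring 0 0 0))
  have h3 := abs_nonneg (g (.offspring 0 0 1))
  have h4 := abs_nonneg (g (.immigration 0))
  rcases a with _ | ⟨k, j, i⟩ | k
  · simp only [rep]; linarith
  · fin_cases i <;> simp only [rep, Fin.zero_eta, Fin.mk_one] <;> linarith
  · simp only [rep]; linarith

theorem IsProcess.identDistrib_rep (hX : IsProcess μ X ξ ε) (a : Idx) :
    IdentDistrib (driving (X 0) ξ ε a) (driving (X 0) ξ ε (rep a)) μ μ := by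
  rcases a with _ | ⟨k, j, i⟩ | k
  · exact IdentDistrib.refl (hX.measurable_driving _).aemeasurable
  · exact hX.identDistrib_offspring k j i
  · exact hX.identDistrib_immigration k

/-- The mean of a driving vector. -/
noncomputable def drivingMean (μ : Measure Ω) (D : Idx → Ω → Fin 2 → ℕ) (a : Idx) (r : Fin 2) : ℝ :=
  ∫ ω, (D a ω r : ℝ) ∂μ

theorem IsProcess.integral_driving_rep (hX : IsProcess μ X ξ ε) (a : Idx) (g : (Fin 2 → ℕ) → ℝ) :
    ∫ ω, g (driving (X 0) ξ ε a ω) ∂μ = ∫ ω, g (driving (X 0) ξ ε (rep a) ω) ∂μ :=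
  ((hX.identDistrib_rep a).comp (u := g) (measurable_of_countable g)).integral_eq

theorem IsProcess.drivingMean_rep (hX : IsProcess μ X ξ ε) (a : Idx) :
    drivingMean μ (driving (X 0) ξ ε) a = drivingMean μ (driving (X 0) ξ ε) (rep a) :=
  funext fun r => hX.integral_driving_rep a fun v => (v r : ℝ)

theorem IsProcess.sum_gen_drivingMean (hX : IsProcess μ X ξ ε) (k : ℕ) (x : Fin 2 → ℕ)
    (r : Fin 2) : ∑ a ∈ gen k x, drivingMean μ (driving (X 0) ξ ε) a r = drift μ ξ ε x r := by
  rw [sum_gen]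
  simp_rw [hX.drivingMean_rep (.offspring _ _ _), hX.drivingMean_rep (.immigration _)]
  simp [rep, drivingMean, driving, drift, offspringMean]

/-- The linear combination with coefficients `c` of the coordinates of a centred driving vector. -/
noncomputable def centred (μ : Measure Ω) (D : Idx → Ω → Fin 2 → ℕ) {τ : Type*}
    (c : τ → Fin 2 → ℝ) (a : Idx) (ω : Ω) (t : τ) : ℝ :=
  ∑ r, c t r * ((D a ω r : ℝ) - drivingMean μ D a r)

/-- The linear combination with coefficients `c` of the coordinates of `next k x z - drift x`. -/
noncomputable def dev (μ : Measure Ω) (ξ : ℕ → ℕ → Fin 2 → Ω → Fin 2 → ℕ)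
    (ε : ℕ → Ω → Fin 2 → ℕ) (c : Fin 2 → ℝ) (x y : Fin 2 → ℕ) : ℝ :=
  ∑ r, c r * ((y r : ℝ) - drift μ ξ ε x r)

theorem IsProcess.sum_gen_centred (hX : IsProcess μ X ξ ε) {τ : Type*} (c : τ → Fin 2 → ℝ)
    (k : ℕ) (x : Fin 2 → ℕ) (ω : Ω) (t : τ) :
    ∑ a ∈ gen k x, centred μ (driving (X 0) ξ ε) c a ω t =
      dev μ ξ ε (c t) x (next k x (innov (driving (X 0) ξ ε) k ω)) := by
  simp only [centred, dev]
  rw [Finset.sum_comm]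
  refine Finset.sum_congr rfl fun r _ => ?_
  rw [← Finset.mul_sum, Finset.sum_sub_distrib, hX.sum_gen_drivingMean, next,
    Finset.sum_congr rfl fun a ha => innov_of_mem_gen _ ha ω]
  simp

/-- Each factor is at most `∑ t, |f t|` in absolute value, so the product is dominated by a power of
that sum. -/
theorem integrable_prod_of_memLp [IsProbabilityMeasure μ] {τ : Type*} [Fintype τ] {ℓ : ℕ}
    {f : τ → Ω → ℝ} (hf : ∀ t, MemLp (f t) ℓ μ) (T : Finset τ) (hT : T.card ≤ ℓ) :
    Integrable (fun ω => ∏ t ∈ T, f t ω) μ := by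
  have h1 : MemLp (fun ω => ∑ t, |f t ω|) T.card μ :=
    (memLp_finsetSum _ fun t _ => (hf t).abs).mono_exponent (by exact_mod_cast hT)
  refine h1.integrable_norm_pow'.mono'
    (Finset.aestronglyMeasurable_fun_prod _ fun t _ => (hf t).1)
    (Filter.Eventually.of_forall fun ω => ?_)
  rw [Real.norm_eq_abs, Finset.abs_prod, ← Finset.prod_const]
  refine Finset.prod_le_prod (fun t _ => abs_nonneg _) fun t _ => ?_
  rw [Real.norm_eq_abs]
  exact (Finset.single_le_sum (f := fun t => |f t ω|) (fun t _ => abs_nonneg _)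
    (Finset.mem_univ t)).trans (le_abs_self _)

/-- The population `x` is frozen and the constant does not depend on it. One coefficient vector per
factor covers both powers of a linear form and coordinates of Kronecker powers. -/
theorem IsProcess.exists_moment_bound [IsProbabilityMeasure μ] (hX : IsProcess μ X ξ ε) {ℓ p : ℕ}
    (hmem : ∀ a r, MemLp (fun ω => (driving (X 0) ξ ε a ω r : ℝ)) ℓ μ) (hℓ : 1 ≤ ℓ)
    (hp : p ≤ ℓ) (c : Fin p → Fin 2 → ℝ) :
    ∃ C : ℝ, 0 ≤ C ∧ ∀ k x,
      Integrable (fun ω => ∏ t, dev μ ξ ε (c t) x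
        (next k x (innov (driving (X 0) ξ ε) k ω))) μ ∧
      |∫ ω, ∏ t, dev μ ξ ε (c t) x (next k x (innov (driving (X 0) ξ ε) k ω)) ∂μ| ≤
        C * ((x 0 : ℝ) + x 1 + 1) ^ (p / 2) := by
  set D := driving (X 0) ξ ε with hD
  set Y : Idx → Ω → Fin p → ℝ := centred μ D c with hY
  have hφ : ∀ a, Measurable fun v : Fin 2 → ℕ => fun t : Fin p =>
      ∑ r, c t r * ((v r : ℝ) - drivingMean μ D a r) := fun a => measurable_of_countable _
  have hm : ∀ a, Measurable (Y a) := fun a => (hφ a).comp (hX.measurable_driving a)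
  have hind : iIndepFun Y μ := hX.indep.comp _ hφ
  have hYmem : ∀ a t, MemLp (fun ω => Y a ω t) ℓ μ := fun a t =>
    memLp_finsetSum _ fun r _ => ((hmem a r).sub (memLp_const _)).const_mul _
  have hint : ∀ a (T : Finset (Fin p)), Integrable (fun ω => ∏ t ∈ T, Y a ω t) μ := fun a T =>
    integrable_prod_of_memLp (hYmem a) T (by simpa using (Finset.card_le_univ T).trans (by simpa))
  have hDint : ∀ a r, Integrable (fun ω => (D a ω r : ℝ)) μ := fun a r =>
    (hmem a r).integrable (by exact_mod_cast hℓ)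
  have hzero : ∀ a t, ∫ ω, Y a ω t ∂μ = 0 := by
    intro a t
    simp only [hY, centred]
    have h : ∀ r, Integrable (fun ω => c t r * ((D a ω r : ℝ) - drivingMean μ D a r)) μ :=
      fun r => ((hDint a r).sub (integrable_const _)).const_mul _
    rw [integral_finsetSum _ fun r _ => h r]
    refine Finset.sum_eq_zero fun r _ => ?_
    rw [integral_const_mul, integral_sub (hDint a r) (integrable_const _)]
    simp [drivingMean]
  have hbd : ∃ K : ℝ, 0 ≤ K ∧ ∀ a (T : Finset (Fin p)), |∫ ω, ∏ t ∈ T, Y a ω t ∂μ| ≤ K := by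
    have hrep : ∀ a (T : Finset (Fin p)), ∫ ω, ∏ t ∈ T, Y a ω t ∂μ =
        ∫ ω, ∏ t ∈ T, Y (rep a) ω t ∂μ := by
      intro a T
      simp only [hY, centred, hD, hX.drivingMean_rep a]
      exact hX.integral_driving_rep a fun v => ∏ t ∈ T, ∑ r, c t r *
        ((v r : ℝ) - drivingMean μ (driving (X 0) ξ ε) (rep a) r)
    choose K hK0 hK using fun T : Finset (Fin p) =>
      exists_bound_of_rep fun a => ∫ ω, ∏ t ∈ T, Y a ω t ∂μ
    refine ⟨∑ T, K T, Finset.sum_nonneg fun T _ => hK0 T, fun a T => ?_⟩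
    rw [hrep]
    exact (hK T a).trans (Finset.single_le_sum (fun T _ => hK0 T) (Finset.mem_univ T))
  obtain ⟨K, hK0, hK⟩ := hbd
  obtain ⟨C, hC0, hC⟩ := exists_abs_integral_prod_sum_le hm hind hint hzero hK0 hK Finset.univ
  refine ⟨C, hC0, fun k x => ⟨?_, ?_⟩⟩
  · have := integrable_prod_sum hm hind hint (gen k x) Finset.univ
    simpa only [hY, hD, hX.sum_gen_centred] using this
  · have := hC (gen k x)
    rw [card_gen, Finset.card_univ, Fintype.card_fin] at this
    push_cast at this
    simpa only [hY, hD, hX.sum_gen_centred] using this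

end

end GWI

/-! ### Moments of the total population -/

namespace GWI

theorem add_pow_le_pow_add_mul {y m : ℝ} (hy : 0 ≤ y) (hm : 0 ≤ m) (p : ℕ) :
    (y + m) ^ p ≤ y ^ p + p * m * (y + m) ^ (p - 1) := by
  induction p with
  | zero => simp
  | succ p ih =>
    have h1 : (p : ℝ) * (y + m) ^ (p - 1) * (y + m) = p * (y + m) ^ p := by
      rcases p with _ | p
      · simp
      · rw [Nat.add_sub_cancel, pow_succ]; ring
    have h2 : y ^ p ≤ (y + m) ^ p := pow_le_pow_left₀ hy (by linarith) p
    calc (y + m) ^ (p + 1) = (y + m) ^ p * (y + m) := pow_succ _ _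
      _ ≤ (y ^ p + p * m * (y + m) ^ (p - 1)) * (y + m) := by gcongr
      _ = y ^ (p + 1) + y ^ p * m + m * ((p : ℝ) * (y + m) ^ (p - 1) * (y + m)) := by ring
      _ = y ^ (p + 1) + y ^ p * m + m * (p * (y + m) ^ p) := by rw [h1]
      _ ≤ y ^ (p + 1) + (y + m) ^ p * m + m * (p * (y + m) ^ p) := by gcongr
      _ = _ := by push_cast [Nat.add_sub_cancel]; ring

theorem norm_le_sum_abs {τ : Type*} [Fintype τ] (v : EuclideanSpace ℝ τ) : ‖v‖ ≤ ∑ t, |v t| := by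
  rw [EuclideanSpace.norm_eq]
  exact Real.sqrt_le_iff.2 ⟨Finset.sum_nonneg fun t _ => abs_nonneg _,
    Finset.sum_sq_le_sq_sum_of_nonneg fun t _ => norm_nonneg _⟩

/-- Convexity: `δ * v + s` is the average of `±v` and `s / (1 - |δ|)` with weights `|δ|` and `1 -
|δ|`; evenness removes the sign. -/
theorem even_pow_le_convex {δ : ℝ} (hδ : |δ| < 1) {n : ℕ} (hn : Even n) (v s : ℝ) :
    (δ * v + s) ^ n ≤ |δ| * v ^ n + (1 - |δ|) * (s / (1 - |δ|)) ^ n := by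
  have h1 : (0 : ℝ) < 1 - |δ| := by linarith
  have key : ∀ w : ℝ, (|δ| * w + s) ^ n ≤ |δ| * w ^ n + (1 - |δ|) * (s / (1 - |δ|)) ^ n := by
    intro w
    have := hn.convexOn_pow.2 (Set.mem_univ w) (Set.mem_univ (s / (1 - |δ|))) (abs_nonneg δ) h1.le
      (by ring)
    simpa [smul_eq_mul, mul_div_cancel₀ s h1.ne'] using this
  rcases le_total 0 δ with h | h
  · have := key v
    rwa [abs_of_nonneg h] at this ⊢
  · have := key (-v)
    rw [hn.neg_pow, abs_of_nonpos h] at this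
    rw [abs_of_nonpos h]
    simpa using this

section

variable {Ω : Type*} [MeasurableSpace Ω] {μ : Measure Ω}
  {X : ℕ → Ω → Fin 2 → ℕ} {ξ : ℕ → ℕ → Fin 2 → Ω → Fin 2 → ℕ} {ε : ℕ → Ω → Fin 2 → ℕ} {ℓ : ℕ}

theorem memLp_of_integrable_pow {f : Ω → ℝ} (hf : AEStronglyMeasurable f μ) (hℓ : 1 ≤ ℓ)
    (h : Integrable (fun ω => |f ω| ^ ℓ) μ) : MemLp f ℓ μ := by
  rw [← integrable_norm_rpow_iff hf (by simpa using by omega) (by simp)]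
  simpa using h

theorem integrable_pow_of_memLp [IsProbabilityMeasure μ] {f : Ω → ℝ} (hf : MemLp f ℓ μ)
    {p : ℕ} (hp : p ≤ ℓ) : Integrable (fun ω => f ω ^ p) μ := by
  have := integrable_prod_of_memLp (τ := Fin p) (f := fun _ => f) (fun _ => hf) Finset.univ
    (by simpa using hp)
  simpa using this

theorem IsProcess.memLp_driving [IsProbabilityMeasure μ] (hX : IsProcess μ X ξ ε)
    (hzero : ∀ ω, X 0 ω = 0) (hℓ : 1 ≤ ℓ)
    (hξ₁ : Integrable (fun ω => ‖toVec (ξ 0 0 0 ω)‖ ^ ℓ) μ)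
    (hξ₂ : Integrable (fun ω => ‖toVec (ξ 0 0 1 ω)‖ ^ ℓ) μ)
    (hε : Integrable (fun ω => ‖toVec (ε 0 ω)‖ ^ ℓ) μ) (a : Idx) (r : Fin 2) :
    MemLp (fun ω => (driving (X 0) ξ ε a ω r : ℝ)) ℓ μ := by
  have hmeas : ∀ a, Measurable fun ω => (driving (X 0) ξ ε a ω r : ℝ) := fun a =>
    (measurable_of_countable fun v : Fin 2 → ℕ => (v r : ℝ)).comp (hX.measurable_driving a)
  have key : ∀ a, Integrable (fun ω => ‖toVec (driving (X 0) ξ ε a ω)‖ ^ ℓ) μ →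
      MemLp (fun ω => (driving (X 0) ξ ε a ω r : ℝ)) ℓ μ := by
    intro a ha
    refine memLp_of_integrable_pow (hmeas a).aestronglyMeasurable hℓ (ha.mono'
      ((hmeas a).abs.pow_const ℓ).aestronglyMeasurable (Filter.Eventually.of_forall fun ω => ?_))
    rw [Real.norm_eq_abs, abs_pow, abs_abs]
    exact pow_le_pow_left₀ (abs_nonneg _) (PiLp.norm_apply_le (toVec _) r) _
  have hrep : MemLp (fun ω => (driving (X 0) ξ ε (rep a) ω r : ℝ)) ℓ μ := by
    refine key _ ?_
    rcases a with _ | ⟨k, j, i⟩ | k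
    · simp only [rep, driving, hzero]
      exact integrable_const _
    · fin_cases i
      · exact hξ₁
      · exact hξ₂
    · exact hε
  exact ((hX.identDistrib_rep a).comp (u := fun v : Fin 2 → ℕ => (v r : ℝ))
    (measurable_of_countable _)).memLp_iff.2 hrep

/-- Doubly symmetric critical offspring means. -/
structure Critical (μ : Measure Ω) (ξ : ℕ → ℕ → Fin 2 → Ω → Fin 2 → ℕ) (δ : ℝ) : Prop where
  abs_lt : |δ| < 1
  mean_sum : ∀ i, offspringMean μ ξ 0 i + offspringMean μ ξ 1 i = 1
  mean_sub_zero : offspringMean μ ξ 0 0 - offspringMean μ ξ 1 0 = δ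
  mean_sub_one : offspringMean μ ξ 0 1 - offspringMean μ ξ 1 1 = -δ

theorem IsProcess.exists_pow_moment_bound [IsProbabilityMeasure μ] (hX : IsProcess μ X ξ ε)
    (hmem : ∀ a r, MemLp (fun ω => (driving (X 0) ξ ε a ω r : ℝ)) ℓ μ) (hℓ : 1 ≤ ℓ) {p : ℕ}
    (hp : p ≤ ℓ) (c : Fin 2 → ℝ) :
    ∃ C : ℝ, 0 ≤ C ∧ ∀ k x,
      Integrable (fun ω => dev μ ξ ε c x (next k x (innov (driving (X 0) ξ ε) k ω)) ^ p) μ ∧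
      |∫ ω, dev μ ξ ε c x (next k x (innov (driving (X 0) ξ ε) k ω)) ^ p ∂μ| ≤
        C * ((x 0 : ℝ) + x 1 + 1) ^ (p / 2) := by
  simpa using hX.exists_moment_bound hmem hℓ hp (fun _ => c)

theorem dev_one {δ : ℝ} (hc : Critical μ ξ δ) (x y : Fin 2 → ℕ) :
    (1 : ℝ) + y 0 + y 1 = dev μ ξ ε 1 x y +
      (1 + x 0 + x 1 + ((∫ ω, (ε 0 ω 0 : ℝ) ∂μ) + ∫ ω, (ε 0 ω 1 : ℝ) ∂μ)) := by
  have h0 := hc.mean_sum 0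
  have h1 := hc.mean_sum 1
  simp only [dev, drift, Fin.sum_univ_two, Pi.one_apply, one_mul]
  linear_combination (x 0 : ℝ) * h0 + (x 1 : ℝ) * h1

theorem dev_sub {δ : ℝ} (hc : Critical μ ξ δ) (x y : Fin 2 → ℕ) :
    (y 0 : ℝ) - y 1 = δ * ((x 0 : ℝ) - x 1) + (dev μ ξ ε ![1, -1] x y +
      ((∫ ω, (ε 0 ω 0 : ℝ) ∂μ) - ∫ ω, (ε 0 ω 1 : ℝ) ∂μ)) := by
  have h0 := hc.mean_sub_zero
  have h1 := hc.mean_sub_one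
  simp only [dev, drift, Fin.sum_univ_two, Matrix.cons_val_zero, Matrix.cons_val_one]
  linear_combination (x 0 : ℝ) * h0 + (x 1 : ℝ) * h1

/-- In the binomial expansion around the conditional mean `u + m`, the term with the `i`-th power of
the deviation has order `⌊i/2⌋ + p - i`, at most `p - 1` for `i ≥ 1`. By criticality the leading
coefficient is exactly `1`. Working with `1 + U` keeps the base at least `1`, so powers are
comparable. -/
theorem IsProcess.exists_total_step [IsProbabilityMeasure μ] (hX : IsProcess μ X ξ ε)
    {δ : ℝ} (hc : Critical μ ξ δ)
    (hmem : ∀ a r, MemLp (fun ω => (driving (X 0) ξ ε a ω r : ℝ)) ℓ μ) (hℓ : 1 ≤ ℓ) {p : ℕ}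
    (hp : p ≤ ℓ) :
    ∃ C : ℝ, 0 ≤ C ∧ ∀ k (x : Fin 2 → ℕ),
      Integrable (fun ω => ((1 : ℝ) + next k x (innov (driving (X 0) ξ ε) k ω) 0 +
        next k x (innov (driving (X 0) ξ ε) k ω) 1) ^ p) μ ∧
      ∫ ω, ((1 : ℝ) + next k x (innov (driving (X 0) ξ ε) k ω) 0 +
        next k x (innov (driving (X 0) ξ ε) k ω) 1) ^ p ∂μ ≤
        (1 + x 0 + x 1 : ℝ) ^ p + C * (1 + x 0 + x 1 : ℝ) ^ (p - 1) := by
  set m : ℝ := (∫ ω, (ε 0 ω 0 : ℝ) ∂μ) + ∫ ω, (ε 0 ω 1 : ℝ) ∂μ with hm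
  have hm0 : 0 ≤ m := add_nonneg (integral_nonneg fun _ => Nat.cast_nonneg _)
    (integral_nonneg fun _ => Nat.cast_nonneg _)
  have hmom : ∀ i, i ≤ p → _ := fun i hi =>
    hX.exists_pow_moment_bound hmem hℓ (hi.trans hp) (1 : Fin 2 → ℝ)
  choose! K hK0 hK using hmom
  set B : ℝ := ∑ i ∈ Finset.range p, K (i + 1) * (p.choose (i + 1)) with hB
  have hB0 : 0 ≤ B := Finset.sum_nonneg fun i hi =>
    mul_nonneg (hK0 _ (by rw [Finset.mem_range] at hi; omega)) (Nat.cast_nonneg _)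
  refine ⟨(p * m + B) * (1 + m) ^ (p - 1), by positivity, fun k x => ?_⟩
  set u : ℝ := 1 + x 0 + x 1 with hu
  have hu1 : 1 ≤ u := by
    have h0 : (0 : ℝ) ≤ x 0 := Nat.cast_nonneg _
    have h1 : (0 : ℝ) ≤ x 1 := Nat.cast_nonneg _
    linarith
  have hu' : (x 0 : ℝ) + x 1 + 1 = u := by rw [hu]; ring
  set R : Ω → ℝ := fun ω => dev μ ξ ε 1 x (next k x (innov (driving (X 0) ξ ε) k ω)) with hR
  have hexp : ∀ ω, ((1 : ℝ) + next k x (innov (driving (X 0) ξ ε) k ω) 0 +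
      next k x (innov (driving (X 0) ξ ε) k ω) 1) ^ p =
      ∑ i ∈ Finset.range (p + 1), R ω ^ i * (u + m) ^ (p - i) * (p.choose i) := fun ω => by
    rw [dev_one hc x, add_pow]
  have hRint : ∀ i ∈ Finset.range (p + 1),
      Integrable (fun ω => R ω ^ i * (u + m) ^ (p - i) * (p.choose i)) μ := fun i hi =>
    (((hK i (by rw [Finset.mem_range] at hi; omega) k x).1).mul_const _).mul_const _
  simp_rw [hexp]
  refine ⟨integrable_finsetSum _ hRint, ?_⟩
  rw [integral_finsetSum _ hRint, Finset.sum_range_succ']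
  simp_rw [integral_mul_const]
  have hterm : ∀ i ∈ Finset.range p,
      (∫ ω, R ω ^ (i + 1) ∂μ) * (u + m) ^ (p - (i + 1)) * (p.choose (i + 1)) ≤
        K (i + 1) * (p.choose (i + 1)) * (u + m) ^ (p - 1) := by
    intro i hi
    rw [Finset.mem_range] at hi
    have h1 := (le_abs_self _).trans ((hK (i + 1) (by omega) k x).2)
    have h2 := hK0 (i + 1) (by omega)
    rw [hu'] at h1
    have h3 : u ^ ((i + 1) / 2) * (u + m) ^ (p - (i + 1)) ≤ (u + m) ^ (p - 1) := by
      calc _ ≤ (u + m) ^ ((i + 1) / 2) * (u + m) ^ (p - (i + 1)) := by gcongr; linarith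
        _ = (u + m) ^ ((i + 1) / 2 + (p - (i + 1))) := (pow_add _ _ _).symm
        _ ≤ _ := pow_le_pow_right₀ (by linarith) (by omega)
    calc _ ≤ (K (i + 1) * u ^ ((i + 1) / 2)) * (u + m) ^ (p - (i + 1)) * (p.choose (i + 1)) := by
          gcongr
      _ = K (i + 1) * (p.choose (i + 1)) * (u ^ ((i + 1) / 2) * (u + m) ^ (p - (i + 1))) := by ring
      _ ≤ _ := by gcongr
  have hsum := Finset.sum_le_sum hterm
  rw [← Finset.sum_mul, ← hB] at hsum
  have hz : (∫ ω, R ω ^ 0 ∂μ) * (u + m) ^ (p - 0) * (p.choose 0) = (u + m) ^ p := by simp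
  rw [hz]
  have hpow := add_pow_le_pow_add_mul (by linarith : 0 ≤ u) hm0 p
  have hum : (u + m) ^ (p - 1) ≤ ((1 + m) * u) ^ (p - 1) :=
    pow_le_pow_left₀ (by linarith) (by nlinarith) _
  calc _ ≤ B * (u + m) ^ (p - 1) + (u ^ p + p * m * (u + m) ^ (p - 1)) := add_le_add hsum hpow
    _ = u ^ p + (p * m + B) * (u + m) ^ (p - 1) := by ring
    _ ≤ u ^ p + (p * m + B) * ((1 + m) * u) ^ (p - 1) := by gcongr
    _ = _ := by rw [mul_pow]; ring

theorem IsProcess.measurable_comp (hX : IsProcess μ X ξ ε) (k : ℕ) (g : (Fin 2 → ℕ) → ℝ) :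
    Measurable fun ω => g (X k ω) := (measurable_of_countable g).comp (hX.measurable k)

theorem measurable_uncurry_next (k : ℕ)
    (g : (Fin 2 → ℕ) → (Fin 2 → ℕ) → ℝ) :
    Measurable (Function.uncurry fun x z => g x (next k x z)) :=
  (measurable_of_countable (Function.uncurry g)).comp
    (measurable_fst.prodMk (measurable_next k))

theorem IsProcess.integral_succ_le [IsProbabilityMeasure μ] (hX : IsProcess μ X ξ ε) (k : ℕ)
    {g : (Fin 2 → ℕ) → (Fin 2 → ℕ) → ℝ} {b : (Fin 2 → ℕ) → ℝ}
    (hg : Integrable (fun ω => g (X k ω) (X (k + 1) ω)) μ)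
    (hb : Integrable (fun ω => b (X k ω)) μ)
    (hle : ∀ x, |∫ ω, g x (next k x (innov (driving (X 0) ξ ε) k ω)) ∂μ| ≤ b x) :
    |∫ ω, g (X k ω) (X (k + 1) ω) ∂μ| ≤ ∫ ω, b (X k ω) ∂μ := by
  simp_rw [hX.succ_eq_next] at hg ⊢
  have h := integrable_integral_of_indepFun (hX.indepFun_innov (measurable_history_self X k))
    (hX.measurable k) (hX.measurable_innov k) (measurable_uncurry_next k g) hg
  rw [h.2]
  exact (abs_integral_le_integral_abs).trans (integral_mono h.1.abs hb fun ω => hle _)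

/-- Induction on the order, then on the generation: each step adds at most `B` times the moment of
one order less, already known to be `O(k ^ p)`. -/
theorem IsProcess.exists_total_moment_bound [IsProbabilityMeasure μ] (hX : IsProcess μ X ξ ε)
    {δ : ℝ} (hc : Critical μ ξ δ) (hzero : ∀ ω, X 0 ω = 0)
    (hmem : ∀ a r, MemLp (fun ω => (driving (X 0) ξ ε a ω r : ℝ)) ℓ μ) (hℓ : 1 ≤ ℓ) {p : ℕ}
    (hp : p ≤ ℓ) :
    ∃ C : ℝ, 0 ≤ C ∧ ∀ k, Integrable (fun ω => (1 + X k ω 0 + X k ω 1 : ℝ) ^ p) μ ∧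
      ∫ ω, (1 + X k ω 0 + X k ω 1 : ℝ) ^ p ∂μ ≤ C * ((k : ℝ) + 1) ^ p := by
  induction p with
  | zero => exact ⟨1, zero_le_one, fun k => by simp⟩
  | succ p ih =>
    obtain ⟨A, hA0, hA⟩ := ih (by omega)
    obtain ⟨B, hB0, hB⟩ := hX.exists_total_step hc hmem hℓ hp
    refine ⟨1 + B * A, by positivity, fun k => ?_⟩
    induction k with
    | zero => simp [hzero]; positivity
    | succ k ihk =>
      have hb : Integrable (fun ω => (1 + X k ω 0 + X k ω 1 : ℝ) ^ (p + 1) +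
          B * (1 + X k ω 0 + X k ω 1 : ℝ) ^ p) μ := ihk.1.add ((hA k).1.const_mul B)
      have hnn : ∀ (x : Fin 2 → ℕ), (0 : ℝ) ≤ (1 + x 0 + x 1 : ℝ) ^ (p + 1) := fun x => by
        positivity
      have hg : Integrable (fun ω => (1 + X (k + 1) ω 0 + X (k + 1) ω 1 : ℝ) ^ (p + 1)) μ := by
        simp_rw [hX.succ_eq_next k]
        refine integrable_uncurry_of_indepFun
          (f := fun x z => ((1 : ℝ) + next k x z 0 + next k x z 1) ^ (p + 1))
          (hX.indepFun_innov (measurable_history_self X k)) (hX.measurable k)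
          (hX.measurable_innov k)
          (measurable_uncurry_next k fun _ y => ((1 : ℝ) + y 0 + y 1) ^ (p + 1))
          (fun x => (hB k x).1) (hb.mono' (hX.measurable_comp k fun x =>
            ∫ ω', |((1 : ℝ) + next k x (innov (driving (X 0) ξ ε) k ω') 0 +
              next k x (innov (driving (X 0) ξ ε) k ω') 1) ^ (p + 1)| ∂μ).aestronglyMeasurable
            (Filter.Eventually.of_forall fun ω => ?_))
        rw [Real.norm_eq_abs, abs_of_nonneg (integral_nonneg fun _ => abs_nonneg _)]
        simp_rw [abs_of_nonneg (hnn _)]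
        exact (hB k _).2
      refine ⟨hg, ?_⟩
      have h := hX.integral_succ_le k
        (g := fun _ y => (1 + y 0 + y 1 : ℝ) ^ (p + 1))
        (b := fun x => (1 + x 0 + x 1 : ℝ) ^ (p + 1) + B * (1 + x 0 + x 1 : ℝ) ^ p) hg hb
        (fun x => by
          rw [abs_of_nonneg (integral_nonneg fun _ => hnn _)]
          exact (hB k x).2)
      rw [integral_add ihk.1 ((hA k).1.const_mul B), integral_const_mul] at h
      have hA' := mul_le_mul_of_nonneg_left (hA k).2 hB0
      have hk0 : (0 : ℝ) ≤ k := Nat.cast_nonneg _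
      have hmono : ((k : ℝ) + 1) ^ p ≤ ((k : ℝ) + 1 + 1) ^ p :=
        pow_le_pow_left₀ (by positivity) (by linarith) _
      push_cast
      calc _ ≤ (1 + B * A) * ((k : ℝ) + 1) ^ (p + 1) + B * (A * ((k : ℝ) + 1) ^ p) :=
            ((le_abs_self _).trans h).trans (add_le_add ihk.2 hA')
        _ ≤ (1 + B * A) * ((k : ℝ) + 1) ^ (p + 1) + (1 + B * A) * ((k : ℝ) + 1) ^ p := by
            have : 0 ≤ ((k : ℝ) + 1) ^ p := by positivity
            nlinarith
        _ = (1 + B * A) * (((k : ℝ) + 1 + 1) * ((k : ℝ) + 1) ^ p) := by ring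
        _ ≤ (1 + B * A) * (((k : ℝ) + 1 + 1) * ((k : ℝ) + 1 + 1) ^ p) := by gcongr
        _ = _ := by ring

end

end GWI

/-! ### Moments of the difference of the two types -/

namespace GWI

/-- Bounds in `k + 1` let the inductions start at `k = 0`; for `k ≥ 1` they cost a factor `2 ^ p`.
-/
theorem meanBigO_of_shifted {Ω : Type*} [MeasurableSpace Ω] {μ : Measure Ω} {F : Type*}
    [NormedAddCommGroup F] [NormedSpace ℝ F] {Y : ℕ → Ω → F} {p : ℕ}
    (hint : ∀ k, 1 ≤ k → Integrable (Y k) μ) {C : ℝ} (hC : 0 ≤ C)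
    (h : ∀ k, 1 ≤ k → ‖∫ ω, Y k ω ∂μ‖ ≤ C * ((k : ℝ) + 1) ^ p) : MeanBigO μ Y p := by
  refine ⟨hint, C * 2 ^ p, fun k hk => (h k hk).trans ?_⟩
  have hk' : (1 : ℝ) ≤ k := by exact_mod_cast hk
  rw [mul_assoc, ← mul_pow]
  gcongr
  linarith

section

variable {Ω : Type*} [MeasurableSpace Ω] {μ : Measure Ω} [IsProbabilityMeasure μ]
  {X : ℕ → Ω → Fin 2 → ℕ} {ξ : ℕ → ℕ → Fin 2 → Ω → Fin 2 → ℕ} {ε : ℕ → Ω → Fin 2 → ℕ} {ℓ : ℕ}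

theorem IsProcess.memLp_coord (hX : IsProcess μ X ξ ε) {δ : ℝ}
    (hc : Critical μ ξ δ) (hzero : ∀ ω, X 0 ω = 0)
    (hmem : ∀ a r, MemLp (fun ω => (driving (X 0) ξ ε a ω r : ℝ)) ℓ μ) (hℓ : 1 ≤ ℓ) (k : ℕ)
    (r : Fin 2) : MemLp (fun ω => (X k ω r : ℝ)) ℓ μ := by
  obtain ⟨C, -, hC⟩ := hX.exists_total_moment_bound hc hzero hmem hℓ le_rfl
  refine memLp_of_integrable_pow (hX.measurable_comp k fun x => (x r : ℝ)).aestronglyMeasurable hℓ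
    ((hC k).1.mono' (hX.measurable_comp k fun x => |(x r : ℝ)| ^ ℓ).aestronglyMeasurable
      (Filter.Eventually.of_forall fun ω => ?_))
  rw [Real.norm_eq_abs, abs_pow, abs_abs, Nat.abs_cast]
  refine pow_le_pow_left₀ (Nat.cast_nonneg _) ?_ _
  have h0 : (0 : ℝ) ≤ X k ω 0 := Nat.cast_nonneg _
  have h1 : (0 : ℝ) ≤ X k ω 1 := Nat.cast_nonneg _
  fin_cases r <;> simp only [Fin.zero_eta, Fin.mk_one] <;> linarith

theorem memLp_dev (hco : ∀ k r, MemLp (fun ω => (X k ω r : ℝ)) ℓ μ) (c : Fin 2 → ℝ) (k : ℕ) :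
    MemLp (fun ω => dev μ ξ ε c (X k ω) (X (k + 1) ω)) ℓ μ :=
  memLp_finsetSum _ fun r _ => (((hco (k + 1) r).sub
    ((((hco k 0).mul_const _).add ((hco k 1).mul_const _)).add (memLp_const _))).const_mul _)

theorem IsProcess.exists_diff_moment_bound (hX : IsProcess μ X ξ ε) {δ : ℝ}
    (hc : Critical μ ξ δ) (hzero : ∀ ω, X 0 ω = 0)
    (hmem : ∀ a r, MemLp (fun ω => (driving (X 0) ξ ε a ω r : ℝ)) ℓ μ) (hℓ : 1 ≤ ℓ) {j : ℕ}
    (hj : 2 * j ≤ ℓ) :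
    ∃ C : ℝ, 0 ≤ C ∧ ∀ k, ∫ ω, V X k ω ^ (2 * j) ∂μ ≤ C * ((k : ℝ) + 1) ^ j := by
  have hco := hX.memLp_coord hc hzero hmem hℓ
  have hV : ∀ k, Integrable (fun ω => V X k ω ^ (2 * j)) μ := fun k =>
    integrable_pow_of_memLp ((hco k 0).sub (hco k 1)) hj
  obtain ⟨A, hA0, hA⟩ := hX.exists_total_moment_bound hc hzero hmem hℓ (p := j) (by omega)
  obtain ⟨B, hB0, hB⟩ := hX.exists_pow_moment_bound hmem hℓ hj ![1, -1]
  have heven : Even (2 * j) := even_two_mul j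
  set θ := |δ| with hθ
  have hθ1 : 0 < 1 - θ := by linarith [hc.abs_lt]
  have hθ0 : 0 ≤ θ := abs_nonneg δ
  set m : ℝ := (∫ ω, (ε 0 ω 0 : ℝ) ∂μ) - ∫ ω, (ε 0 ω 1 : ℝ) ∂μ with hm
  set R : ℕ → Ω → ℝ := fun k ω => dev μ ξ ε ![1, -1] (X k ω) (X (k + 1) ω) with hR
  have hRint : ∀ k, Integrable (fun ω => R k ω ^ (2 * j)) μ := fun k =>
    integrable_pow_of_memLp (memLp_dev hco _ k) hj
  have hRle : ∀ k, ∫ ω, R k ω ^ (2 * j) ∂μ ≤ B * A * ((k : ℝ) + 1) ^ j := by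
    intro k
    have hle := hX.integral_succ_le k (g := fun x y => dev μ ξ ε ![1, -1] x y ^ (2 * j))
      (b := fun x => B * (1 + x 0 + x 1 : ℝ) ^ j) (hRint k) ((hA k).1.const_mul B) (fun x => by
        have := (hB k x).2
        rw [Nat.mul_div_cancel_left j two_pos, add_comm _ (1 : ℝ), ← add_assoc] at this
        exact this)
    rw [integral_const_mul] at hle
    calc _ ≤ B * (A * ((k : ℝ) + 1) ^ j) :=
          ((le_abs_self _).trans hle).trans (mul_le_mul_of_nonneg_left (hA k).2 hB0)
      _ = _ := by ring
  -- `Q` combines the convexity weight with `(a + b) ^ (2 * j) ≤ 2 ^ (2 * j - 1) * (a ^ (2 * j) + b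
  -- ^ (2 * j))`.
  set Q : ℝ := (1 - θ) * (2 ^ (2 * j - 1) / (1 - θ) ^ (2 * j)) with hQ
  have hQ0 : 0 ≤ Q := by positivity
  have hm2 : 0 ≤ m ^ (2 * j) := heven.pow_nonneg m
  have hpt : ∀ k ω, V X (k + 1) ω ^ (2 * j) ≤
      θ * V X k ω ^ (2 * j) + Q * (R k ω ^ (2 * j) + m ^ (2 * j)) := by
    intro k ω
    have h1 := even_pow_le_convex hc.abs_lt heven (V X k ω) (R k ω + m)
    have h2 : V X (k + 1) ω = δ * V X k ω + (R k ω + m) := dev_sub hc _ _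
    rw [h2]
    refine h1.trans (add_le_add le_rfl ?_)
    rw [div_pow, hQ, mul_assoc]
    refine mul_le_mul_of_nonneg_left ?_ hθ1.le
    rw [div_mul_eq_mul_div]
    gcongr
    exact heven.add_pow_le
  set S : ℝ := Q * (B * A + m ^ (2 * j)) with hS
  have hS0 : 0 ≤ S := by positivity
  -- `S / (1 - θ)` is the fixed point of `C ↦ θ * C + S`. The added `1` serves `j = 0`, where the
  -- power of `V X 0 ω = 0` equals `1`.
  refine ⟨S / (1 - θ) + 1, by positivity, fun k => ?_⟩
  induction k with
  | zero =>
    have : ∀ ω, V X 0 ω = 0 := fun ω => by simp [V, hzero]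
    simp_rw [this]
    simp only [integral_const, probReal_univ, smul_eq_mul, one_mul, Nat.cast_zero, zero_add,
      one_pow, mul_one]
    have h1 : (0 : ℝ) ^ (2 * j) ≤ 1 := pow_le_one₀ le_rfl zero_le_one
    have h2 : 0 ≤ S / (1 - θ) := by positivity
    linarith
  | succ k ih =>
    have hR2 : Integrable (fun ω => R k ω ^ (2 * j) + m ^ (2 * j)) μ :=
      (hRint k).add (integrable_const _)
    have h1 := integral_mono (hV (k + 1)) (((hV k).const_mul θ).add (hR2.const_mul Q)) (hpt k)
    simp only [Pi.add_apply] at h1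
    rw [integral_add ((hV k).const_mul θ) (hR2.const_mul Q), integral_const_mul,
      integral_const_mul, integral_add (hRint k) (integrable_const _), integral_const,
      probReal_univ, one_smul] at h1
    have hk0 : (0 : ℝ) ≤ k := Nat.cast_nonneg _
    have hk1 : (1 : ℝ) ≤ ((k : ℝ) + 1) ^ j := one_le_pow₀ (by linarith)
    have hmono : ((k : ℝ) + 1) ^ j ≤ ((k : ℝ) + 1 + 1) ^ j :=
      pow_le_pow_left₀ (by positivity) (by linarith) _
    push_cast
    have hSθ : θ * (S / (1 - θ) + 1) + S ≤ S / (1 - θ) + 1 := by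
      have : (S / (1 - θ)) * (1 - θ) = S := div_mul_cancel₀ _ hθ1.ne'
      nlinarith
    calc _ ≤ θ * ((S / (1 - θ) + 1) * ((k : ℝ) + 1) ^ j) +
          Q * (B * A * ((k : ℝ) + 1) ^ j + m ^ (2 * j) * ((k : ℝ) + 1) ^ j) := by
          refine h1.trans ?_
          gcongr
          · exact hRle k
          · exact le_mul_of_one_le_right hm2 hk1
      _ = (θ * (S / (1 - θ) + 1) + S) * ((k : ℝ) + 1) ^ j := by rw [hS]; ring
      _ ≤ (S / (1 - θ) + 1) * ((k : ℝ) + 1 + 1) ^ j := by gcongr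

/-! ### Conditional means, Kronecker powers and power bounds -/

theorem IsProcess.integral_dev (hX : IsProcess μ X ξ ε)
    (hmem : ∀ a r, MemLp (fun ω => (driving (X 0) ξ ε a ω r : ℝ)) ℓ μ) (hℓ : 1 ≤ ℓ) (k : ℕ)
    (x : Fin 2 → ℕ) (c : Fin 2 → ℝ) :
    ∫ ω, dev μ ξ ε c x (next k x (innov (driving (X 0) ξ ε) k ω)) ∂μ = 0 := by
  have hint : ∀ a r, Integrable (fun ω => c r * ((driving (X 0) ξ ε a ω r : ℝ) -
      drivingMean μ (driving (X 0) ξ ε) a r)) μ := fun a r =>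
    (((hmem a r).integrable (by exact_mod_cast hℓ)).sub (integrable_const _)).const_mul _
  simp_rw [← hX.sum_gen_centred (fun _ : Unit => c) k x _ ()]
  simp only [centred]
  rw [integral_finsetSum _ fun a _ => integrable_finsetSum _ fun r _ => hint a r]
  refine Finset.sum_eq_zero fun a _ => ?_
  rw [integral_finsetSum _ fun r _ => hint a r]
  refine Finset.sum_eq_zero fun r _ => ?_
  rw [integral_const_mul, integral_sub ((hmem a r).integrable (by exact_mod_cast hℓ))
    (integrable_const _)]
  simp [drivingMean]

theorem measurable_uncurry_mul_next (k : ℕ) (g : (Fin 2 → ℕ) → (Fin 2 → ℕ) → ℝ) :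
    Measurable (Function.uncurry fun (h : (Fin 2 → ℕ) × ℝ) (z : Idx → Fin 2 → ℕ) =>
      h.2 * g h.1 (next k h.1 z)) := by
  have hq : Measurable fun q : ((Fin 2 → ℕ) × ℝ) × (Idx → Fin 2 → ℕ) => (q.1.1, q.2) := by
    fun_prop
  exact Measurable.mul (measurable_snd.comp measurable_fst)
    ((measurable_uncurry_next k g).comp hq)

theorem IsProcess.condExp_succ (hX : IsProcess μ X ξ ε)
    (hmem : ∀ a r, MemLp (fun ω => (driving (X 0) ξ ε a ω r : ℝ)) ℓ μ) (hℓ : 1 ≤ ℓ)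
    (hco : ∀ k r, MemLp (fun ω => (X k ω r : ℝ)) ℓ μ) (k : ℕ) :
    (fun ω => (WithLp.toLp 2 (drift μ ξ ε (X k ω)) : EuclideanSpace ℝ (Fin 2))) =ᵐ[μ]
      μ[fun ω => toVec (X (k + 1) ω) | history X k] := by
  have hℓ' : (1 : ENNReal) ≤ ℓ := by exact_mod_cast hℓ
  have hXint : ∀ r, Integrable (fun ω => (X (k + 1) ω r : ℝ)) μ := fun r =>
    (hco (k + 1) r).integrable hℓ'
  have hdint : ∀ r, Integrable (fun ω => drift μ ξ ε (X k ω) r) μ := fun r =>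
    ((((hco k 0).mul_const _).add ((hco k 1).mul_const _)).add (memLp_const _)).integrable hℓ'
  refine ae_eq_condExp_of_forall_setIntegral_eq (hX.history_le k) ?_ ?_ ?_ ?_
  · exact integrable_piLp_iff.2 hXint
  · exact fun s _ _ => (integrable_piLp_iff.2 hdint).integrableOn
  · intro s hs _
    ext r
    refine (eval_integral_piLp (μ := μ.restrict s)
      (f := fun ω => (WithLp.toLp 2 (drift μ ξ ε (X k ω)) : EuclideanSpace ℝ (Fin 2)))
      (fun r => (hdint r).integrableOn) r).trans (Eq.trans ?_ (eval_integral_piLp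
      (μ := μ.restrict s) (f := fun ω => toVec (X (k + 1) ω))
      (fun r => (hXint r).integrableOn) r).symm)
    have hs' : MeasurableSet s := hX.history_le k s hs
    have hdev : ∀ x y : Fin 2 → ℕ,
        dev μ ξ ε (Pi.single r 1) x y = (y r : ℝ) - drift μ ξ ε x r := fun x y => by
      simp [dev, Pi.single_apply]
    -- The indicator of the test event is stored next to `X k`, so freezing `H` leaves a multiple of
    -- a centred deviation, whose mean is zero.
    set H : Ω → (Fin 2 → ℕ) × ℝ := fun ω => (X k ω, s.indicator (fun _ => (1 : ℝ)) ω) with hH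
    have hHm : Measurable[history X k] H := (measurable_history_self X k).prodMk
      (Measurable.indicator measurable_const hs)
    have hind : (fun ω => (H ω).2 * dev μ ξ ε (Pi.single r 1) (H ω).1
        (next k (H ω).1 (innov (driving (X 0) ξ ε) k ω))) =
        s.indicator fun ω => (X (k + 1) ω r : ℝ) - drift μ ξ ε (X k ω) r := by
      ext ω
      simp only [hH]
      rw [← hX.succ_eq_next, hdev]
      by_cases hω : ω ∈ s <;> simp [hω]
    have key := (integrable_integral_of_indepFun (hX.indepFun_innov hHm)
      (hHm.mono (hX.history_le k) le_rfl) (hX.measurable_innov k)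
      (measurable_uncurry_mul_next k (dev μ ξ ε (Pi.single r 1))) (by
        rw [hind]
        exact ((hXint r).sub (hdint r)).indicator hs')).2
    simp_rw [integral_const_mul, hX.integral_dev hmem hℓ, mul_zero, integral_zero] at key
    rw [hind, integral_indicator hs',
      integral_sub (hXint r).integrableOn (hdint r).integrableOn] at key
    exact (sub_eq_zero.1 key).symm
  · refine StronglyMeasurable.aestronglyMeasurable ?_
    exact ((measurable_of_countable fun x : Fin 2 → ℕ =>
      (WithLp.toLp 2 (drift μ ξ ε x) : EuclideanSpace ℝ (Fin 2))).comp
        (measurable_history_self X k)).stronglyMeasurable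

theorem IsProcess.kronPow_M_ae_eq (hX : IsProcess μ X ξ ε)
    (hmem : ∀ a r, MemLp (fun ω => (driving (X 0) ξ ε a ω r : ℝ)) ℓ μ) (hℓ : 1 ≤ ℓ)
    (hco : ∀ k r, MemLp (fun ω => (X k ω r : ℝ)) ℓ μ) (k : ℕ) (s : Fin ℓ → Fin 2) :
    (fun ω => kronPow ℓ (M μ X (k + 1) ω) s) =ᵐ[μ]
      fun ω => ∏ t, dev μ ξ ε (Pi.single (s t) 1) (X k ω) (X (k + 1) ω) := by
  filter_upwards [hX.condExp_succ hmem hℓ hco k] with ω hω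
  have hM : M μ X (k + 1) ω = toVec (X (k + 1) ω) - WithLp.toLp 2 (drift μ ξ ε (X k ω)) := by
    rw [M, hω]
    rfl
  simp only [kronPow, hM]
  refine Finset.prod_congr rfl fun t _ => ?_
  simp [toVec, dev, Pi.single_apply]

theorem IsProcess.meanBigO_kronPow (hX : IsProcess μ X ξ ε) {δ : ℝ}
    (hc : Critical μ ξ δ) (hzero : ∀ ω, X 0 ω = 0)
    (hmem : ∀ a r, MemLp (fun ω => (driving (X 0) ξ ε a ω r : ℝ)) ℓ μ) (hℓ : 1 ≤ ℓ) :
    MeanBigO μ (fun k ω => kronPow ℓ (M μ X k ω)) (ℓ / 2) := by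
  have hco := hX.memLp_coord hc hzero hmem hℓ
  have hint : ∀ k (s : Fin ℓ → Fin 2), Integrable
      (fun ω => ∏ t, dev μ ξ ε (Pi.single (s t) 1) (X k ω) (X (k + 1) ω)) μ := fun k s =>
    integrable_prod_of_memLp (fun t => memLp_dev hco (Pi.single (s t) 1) k) Finset.univ (by simp)
  have hint' : ∀ k (s : Fin ℓ → Fin 2),
      Integrable (fun ω => kronPow ℓ (M μ X (k + 1) ω) s) μ := fun k s =>
    (hint k s).congr (hX.kronPow_M_ae_eq hmem hℓ hco k s).symm
  obtain ⟨A, hA0, hA⟩ := hX.exists_total_moment_bound hc hzero hmem hℓ (p := ℓ / 2) (by omega)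
  choose B hB0 hB using fun s : Fin ℓ → Fin 2 =>
    hX.exists_moment_bound hmem hℓ le_rfl fun t => Pi.single (s t) (1 : ℝ)
  refine meanBigO_of_shifted (C := ∑ s, B s * A) (fun k hk => ?_)
    (Finset.sum_nonneg fun s _ => mul_nonneg (hB0 s) hA0) (fun k hk => ?_)
  · obtain ⟨k, rfl⟩ := Nat.exists_eq_add_of_le' hk
    exact integrable_piLp_iff.2 (hint' k)
  · obtain ⟨k, rfl⟩ := Nat.exists_eq_add_of_le' hk
    refine (norm_le_sum_abs _).trans ?_
    rw [Finset.sum_mul]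
    refine Finset.sum_le_sum fun s _ => ?_
    rw [eval_integral_piLp (hint' k), integral_congr_ae (hX.kronPow_M_ae_eq hmem hℓ hco k s)]
    have hle := hX.integral_succ_le k
      (g := fun x y => ∏ t, dev μ ξ ε (Pi.single (s t) 1) x y)
      (b := fun x => B s * (1 + x 0 + x 1 : ℝ) ^ (ℓ / 2)) (hint k s)
      ((hA k).1.const_mul _) (fun x => by
        have := (hB s k x).2
        rw [add_comm _ (1 : ℝ), ← add_assoc] at this
        exact this)
    rw [integral_const_mul] at hle
    have hk0 : (0 : ℝ) ≤ k := Nat.cast_nonneg _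
    calc _ ≤ B s * (A * ((k : ℝ) + 1) ^ (ℓ / 2)) :=
          hle.trans (mul_le_mul_of_nonneg_left (hA k).2 (hB0 s))
      _ ≤ B s * (A * (((k + 1 : ℕ) : ℝ) + 1) ^ (ℓ / 2)) := by
          have := hB0 s
          gcongr
          linarith
      _ = _ := by ring

/-- Serves both `‖X_k‖` and `U_k`, each dominated by `1 + U_k`. -/
theorem IsProcess.meanBigO_of_abs_le (hX : IsProcess μ X ξ ε) {δ : ℝ}
    (hc : Critical μ ξ δ) (hzero : ∀ ω, X 0 ω = 0)
    (hmem : ∀ a r, MemLp (fun ω => (driving (X 0) ξ ε a ω r : ℝ)) ℓ μ) (hℓ : 1 ≤ ℓ)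
    (g : (Fin 2 → ℕ) → ℝ) (hg : ∀ x, |g x| ≤ (1 + x 0 + x 1 : ℝ)) :
    MeanBigO μ (fun k ω => g (X k ω) ^ ℓ) ℓ := by
  obtain ⟨A, hA0, hA⟩ := hX.exists_total_moment_bound hc hzero hmem hℓ le_rfl
  have hle : ∀ k ω, ‖g (X k ω) ^ ℓ‖ ≤ (1 + X k ω 0 + X k ω 1 : ℝ) ^ ℓ := fun k ω => by
    rw [norm_pow, Real.norm_eq_abs]
    exact pow_le_pow_left₀ (abs_nonneg _) (hg _) _
  refine meanBigO_of_shifted (fun k _ => (hA k).1.mono'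
    (hX.measurable_comp k fun x => g x ^ ℓ).aestronglyMeasurable
    (Filter.Eventually.of_forall (hle k))) hA0 fun k _ => ?_
  exact (norm_integral_le_of_norm_le (hA k).1 (Filter.Eventually.of_forall (hle k))).trans (hA k).2

end

end GWI

theorem corollaryB6 {Ω : Type*} [MeasurableSpace Ω] (μ : Measure Ω) [IsProbabilityMeasure μ]
    (X : ℕ → Ω → Fin 2 → ℕ) (ξ : ℕ → ℕ → Fin 2 → Ω → Fin 2 → ℕ) (ε : ℕ → Ω → Fin 2 → ℕ)
    (hX : GWI.IsProcess μ X ξ ε)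
    (α β : ℝ) (hα : α ∈ Set.Ioo (0 : ℝ) 1) (hβ : β ∈ Set.Ioo (0 : ℝ) 1) (hαβ : α + β = 1)
    (hmean : GWI.offspringMean μ ξ = !![α, β; β, α])
    (hzero : ∀ ω, X 0 ω = 0)
    (ℓ : ℕ) (hℓ : 1 ≤ ℓ)
    (hξ₁ : Integrable (fun ω => ‖GWI.toVec (ξ 0 0 0 ω)‖ ^ ℓ) μ)
    (hξ₂ : Integrable (fun ω => ‖GWI.toVec (ξ 0 0 1 ω)‖ ^ ℓ) μ)
    (hε : Integrable (fun ω => ‖GWI.toVec (ε 0 ω)‖ ^ ℓ) μ) :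
    GWI.MeanBigO μ (fun k ω => ‖GWI.toVec (X k ω)‖ ^ ℓ) ℓ ∧
    GWI.MeanBigO μ (fun k ω => GWI.kronPow ℓ (GWI.M μ X k ω)) (ℓ / 2) ∧
    GWI.MeanBigO μ (fun k ω => GWI.U X k ω ^ ℓ) ℓ ∧
    ∀ j : ℕ, 2 * j ≤ ℓ → GWI.MeanBigO μ (fun k ω => GWI.V X k ω ^ (2 * j)) j := by
  have hmem := hX.memLp_driving hzero hℓ hξ₁ hξ₂ hε
  have hc : GWI.Critical μ ξ (α - β) := by
    -- Since `α + β = 1`, the second eigenvalue `α - β` equals `2α - 1`, which lies strictly between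
    -- `-1` and `1`.
    refine ⟨abs_lt.2 ⟨by linarith [hα.1], by linarith [hα.2]⟩, fun i => ?_, ?_, ?_⟩
    · fin_cases i <;> simp [hmean] <;> linarith
    · simp [hmean]
    · simp [hmean]
  have hco := hX.memLp_coord hc hzero hmem hℓ
  refine ⟨?_, hX.meanBigO_kronPow hc hzero hmem hℓ, ?_, fun j hj => ?_⟩
  · refine hX.meanBigO_of_abs_le hc hzero hmem hℓ (fun x => ‖GWI.toVec x‖) fun x => ?_
    rw [abs_norm]
    refine (GWI.norm_le_sum_abs _).trans ?_
    simp only [GWI.toVec, Fin.sum_univ_two, Nat.abs_cast]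
    linarith
  · refine hX.meanBigO_of_abs_le hc hzero hmem hℓ (fun x => (x 0 : ℝ) + x 1) fun x => ?_
    rw [abs_of_nonneg (by positivity)]
    linarith
  · obtain ⟨C, hC0, hC⟩ := hX.exists_diff_moment_bound hc hzero hmem hℓ hj
    refine GWI.meanBigO_of_shifted
      (fun k _ => GWI.integrable_pow_of_memLp ((hco k 0).sub (hco k 1)) hj) hC0 fun k _ => ?_
    rw [Real.norm_eq_abs,
      abs_of_nonneg (integral_nonneg fun ω => (even_two_mul j).pow_nonneg _)]
    exact hC k
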